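/- A \emph{graph} $\Gamma$ on a (possibly infinite) vertex set $V$ is a reflexive symmetric relation on $V$; a graph homomorphism is a relation-preserving map of vertex sets. The right-angled Artin group (RAAG) of $\Gamma$ is $A\Gamma=\langle v\in V \mid [v_1,v_2]=1 \text{ whenever } (v_1,v_2)\in\Gamma\rangle$, and a graph homomorphism $\varphi:\Gamma\to\Delta$ induces $A\varphi:A\Gamma\to A\Delta$, $v\mapsto\varphi(v)$. For a group $G$, the commutation graph $CG$ has the elements of $G$ as vertices, with $g,h$ related if and only if $gh=hg$; thus $ACG$ is generated by symbols $[g]$ ($g\in G$) subject to the relations $[g][h]=[h][g]$ whenever $gh=hg$. For a homomorphism $f:G\to H$ let $ACf:ACG\to ACH$, $[g]\mapsto[f(g)]$; let $\epsilon_G:ACG\to G$, $[g]\mapsto g$, and $\delta_G:ACG\to AC(ACG)$, $[g]\mapsto[[g]]$. An \emph{$AC$-coalgebra structure} on $G$ is a homomorphism $\mathfrak g:G\to ACG$ with $\epsilon_G\circ\mathfrak g=1_G$ and $AC\mathfrak g\circ\mathfrak g=\delta_G\circ\mathfrak g$. For a graph $\Gamma$, let $\mathfrak c_\Gamma:A\Gamma\to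 AC(A\Gamma)$ be the homomorphism sending each vertex $v$ to $[v]$. (1) A group $G$ is isomorphic to a RAAG if and only if it admits an $AC$-coalgebra structure. For every graph $\Gamma$, $\mathfrak c_\Gamma$ is an $AC$-coalgebra structure on $A\Gamma$. (2) For graphs $\Gamma,\Delta$, a group homomorphism $f:A\Gamma\to A\Delta$ equals $A\varphi$ for some graph homomorphism $\varphi:\Gamma\to\Delta$ if and only if $ACf\circ\mathfrak c_\Gamma=\mathfrak c_\Delta\circ f$. (3) More generally, for every group $G$ with an $AC$-coalgebra structure $\mathfrak g$ there are a graph $\Gamma$ and an isomorphism $e:G\to A\Gamma$ with $ACe\circ\mathfrak g=\mathfrak c_\Gamma\circ e$. If $e:G\to A\Gamma$ and $e':H\to A\Delta$ are any such isomorphisms for groups with $AC$-coalgebra structures $(G,\mathfrak g)$ and $(H,\mathfrak h)$, then a group homomorphism $f:G\to H$ satisfies $e'\circ f=A\varphi\circ e$ for some graph homomorphism $\varphi:\Gamma\to\Delta$ if and only if $ACf\circ\mathfrak g=\mathfrak h\circ f$. -/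

import Mathlib

universe u v w x

open scoped commutatorElement

/-- A graph on the vertex set `V`: a symmetric, reflexive relation on `V`. -/
structure ReflGraph (V : Type u) where
  Adj : V → V → Prop
  refl : ∀ a, Adj a a
  symm : ∀ a b, Adj a b → Adj b a

/-- A graph homomorphism: a function on vertices preserving the relation. -/
@[ext]
structure ReflGraph.Hom {V : Type u} {W : Type v} (Γ : ReflGraph V) (Δ : ReflGraph W) where
  toFun : V → W
  map_adj : ∀ a b, Γ.Adj a b → Δ.Adj (toFun a) (toFun b)

/-- The defining relators of the right-angled Artin group of `Γ`:
the commutators of adjacent vertices. -/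
def RAAG.rels {V : Type u} (Γ : ReflGraph V) : Set (FreeGroup V) :=
  {r | ∃ a b, Γ.Adj a b ∧ r = ⁅FreeGroup.of a, FreeGroup.of b⁆}

/-- The right-angled Artin group `AΓ = ⟨v ∈ V ∣ [a, b] = 1 whenever (a, b) ∈ Γ⟩`. -/
abbrev RAAG {V : Type u} (Γ : ReflGraph V) : Type u :=
  PresentedGroup (RAAG.rels Γ)

namespace RAAG

/-- The generator of `AΓ` given by a vertex. -/
def of {V : Type u} (Γ : ReflGraph V) (a : V) : RAAG Γ :=
  PresentedGroup.of a

theorem commute_of {V : Type u} (Γ : ReflGraph V) {a b : V} (h : Γ.Adj a b) :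
    Commute (of Γ a) (of Γ b) := by
  rw [← commutatorElement_eq_one_iff_commute]
  exact PresentedGroup.one_of_mem (rels := rels Γ) ⟨a, b, h, rfl⟩

/-- The homomorphism out of `AΓ` with prescribed values on the vertices. -/
def lift {V : Type u} (Γ : ReflGraph V) {G : Type v} [Group G] (t : V → G)
    (ht : ∀ a b, Γ.Adj a b → Commute (t a) (t b)) : RAAG Γ →* G :=
  PresentedGroup.toGroup (rels := rels Γ) (f := t) (by
    rintro r ⟨a, b, hab, rfl⟩
    rw [map_commutatorElement, FreeGroup.lift_apply_of, FreeGroup.lift_apply_of]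
    exact commutatorElement_eq_one_iff_commute.mpr (ht a b hab))

theorem lift_of {V : Type u} (Γ : ReflGraph V) {G : Type v} [Group G] (t : V → G)
    (ht : ∀ a b, Γ.Adj a b → Commute (t a) (t b)) (a : V) :
    lift Γ t ht (of Γ a) = t a :=
  PresentedGroup.toGroup.of _

/-- The functor `A` on morphisms: `Aφ : AΓ → AΔ` sends the generator `a` to `φ a`. -/
def map {V : Type u} {W : Type v} {Γ : ReflGraph V} {Δ : ReflGraph W} (φ : Γ.Hom Δ) :
    RAAG Γ →* RAAG Δ :=
  lift Γ (fun a => of Δ (φ.toFun a)) (fun a b h => commute_of Δ (φ.map_adj a b h))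

end RAAG

/-- The commutation graph `CG`: vertices are the elements of `G`, and two of them are
related if and only if they commute. -/
def commGraph (G : Type u) [Group G] : ReflGraph G where
  Adj g h := Commute g h
  refl g := Commute.refl g
  symm _ _ h := h.symm

/-- The functor `C` on morphisms. -/
def commGraph.map {G : Type u} {H : Type v} [Group G] [Group H] (f : G →* H) :
    (commGraph G).Hom (commGraph H) where
  toFun := f
  map_adj _ _ h := Commute.map h f

/-- The group `ACG`. -/
abbrev AC (G : Type u) [Group G] : Type u := RAAG (commGraph G)

/-- The homomorphism `ACf : ACG → ACH`, `[g] ↦ [f g]`. -/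
def AC.map {G : Type u} {H : Type v} [Group G] [Group H] (f : G →* H) : AC G →* AC H :=
  RAAG.map (commGraph.map f)

/-- The counit `ε : ACG → G`, `[g] ↦ g`. -/
def AC.counit (G : Type u) [Group G] : AC G →* G :=
  RAAG.lift (commGraph G) (fun g => g) (fun _ _ h => h)

/-- The unit `η : Γ → CAΓ`, sending a vertex to the corresponding generator. -/
def RAAG.unit {V : Type u} (Γ : ReflGraph V) : Γ.Hom (commGraph (RAAG Γ)) where
  toFun := RAAG.of Γ
  map_adj _ _ h := RAAG.commute_of Γ h

/-- The canonical structure map `Aη : AΓ → AC(AΓ)`, sending each generator `a` to `[a]`. -/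
def RAAG.canonical {V : Type u} (Γ : ReflGraph V) : RAAG Γ →* AC (RAAG Γ) :=
  RAAG.map (RAAG.unit Γ)

/-- The comultiplication `δ : ACG → AC(ACG)`, `[g] ↦ [[g]]`. -/
def AC.comul (G : Type u) [Group G] : AC G →* AC (AC G) :=
  RAAG.map (RAAG.unit (commGraph G))

/-- `𝔤 : G → ACG` is an `AC`-coalgebra structure on `G`: `ε ∘ 𝔤 = 1` and
`AC𝔤 ∘ 𝔤 = δ ∘ 𝔤`. -/
structure IsACCoalgebra {G : Type u} [Group G] (𝔤 : G →* AC G) : Prop where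
  counit_comp : (AC.counit G).comp 𝔤 = MonoidHom.id G
  coassoc : (AC.map 𝔤).comp 𝔤 = (AC.comul G).comp 𝔤

/-- `f : G → H` respects the structure maps: `ACf ∘ 𝔤 = 𝔥 ∘ f`. -/
def IsACCohom {G : Type u} {H : Type v} [Group G] [Group H]
    (𝔤 : G →* AC G) (𝔥 : H →* AC H) (f : G →* H) : Prop :=
  (AC.map f).comp 𝔤 = 𝔥.comp f

/-- `G` is isomorphic to a right-angled Artin group. -/
def IsRAAG (G : Type u) [Group G] : Prop :=
  ∃ (V : Type u) (Γ : ReflGraph V), Nonempty (G ≃* RAAG Γ)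

/-!
The vertices of `AΓ` are visible in the group: no two of them are equal, none is trivial, and two of
them commute exactly when they are adjacent. So the unit `Γ → CAΓ` is a full embedding of graphs.
The group of a full subgraph is a retract, killing the vertices outside it. Retracting
`𝔠 x = [x]` along the unit shows that `x` is a vertex of `AΓ` or trivial, and `[1] ≠ 1` excludes the
latter. Hence the coalgebra structure `𝔠` remembers the vertices, which gives (2).

For a coalgebra `(G, 𝔤)` the candidate for `Γ` is the full subgraph of `CG` on the elements with
`𝔤 g = [g]`, which is the equalizer of `C𝔤` and the unit of `CG`. The counit makes this equalizer a
pullback of full embeddings, so the retractions commute with the induced homomorphisms;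
coassociativity then says that `𝔤 g` is fixed by the retraction of `ACG` onto `AΓ`, so that `𝔤`
identifies `G` with `AΓ`.
-/

section FullEmbedding

variable {V : Type u} {W : Type v} {Γ : ReflGraph V} {Δ : ReflGraph W}

/-- A full embedding of graphs: an isomorphism onto a full (induced) subgraph. -/
structure ReflGraph.Hom.IsFullEmbedding (φ : Γ.Hom Δ) : Prop where
  injective : Function.Injective φ.toFun
  adj_of_adj : ∀ a b, Δ.Adj (φ.toFun a) (φ.toFun b) → Γ.Adj a b

/-- The full (induced) subgraph on a set of vertices. -/
def ReflGraph.induce (Γ : ReflGraph V) (s : Set V) : ReflGraph s where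
  Adj a b := Γ.Adj a b
  refl a := Γ.refl a
  symm a b := Γ.symm a b

/-- The inclusion of a full subgraph. -/
def ReflGraph.induceHom (Γ : ReflGraph V) (s : Set V) : (Γ.induce s).Hom Γ where
  toFun := Subtype.val
  map_adj _ _ h := h

theorem ReflGraph.isFullEmbedding_induceHom (Γ : ReflGraph V) (s : Set V) :
    (Γ.induceHom s).IsFullEmbedding where
  injective := Subtype.val_injective
  adj_of_adj _ _ h := h

theorem commGraph.isFullEmbedding_map {G : Type u} {H : Type v} [Group G] [Group H] {f : G →* H}
    (hf : Function.Injective f) : (commGraph.map f).IsFullEmbedding where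
  injective := hf
  adj_of_adj _ _ h := Commute.of_map hf h

end FullEmbedding

namespace RAAG

section Vertices

variable {V : Type u} {W : Type v} {Γ : ReflGraph V} {Δ : ReflGraph W}

theorem hom_ext {G : Type w} [Group G] {f g : RAAG Γ →* G}
    (h : ∀ a, f (of Γ a) = g (of Γ a)) : f = g :=
  PresentedGroup.ext h

@[simp]
theorem map_of (φ : Γ.Hom Δ) (a : V) : map φ (of Γ a) = of Δ (φ.toFun a) :=
  lift_of Γ _ _ a

@[simp]
theorem canonical_of (a : V) : canonical Γ (of Γ a) = of (commGraph (RAAG Γ)) (of Γ a) :=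
  map_of _ a

/-- The exponent sum of each vertex, that is, the abelianization of `AΓ`. -/
noncomputable def exponentSum (Γ : ReflGraph V) : RAAG Γ →* Multiplicative (V →₀ ℤ) :=
  lift Γ (fun a => .ofAdd (.single a 1)) fun _ _ _ => Commute.all _ _

theorem exponentSum_of (a : V) : exponentSum Γ (of Γ a) = .ofAdd (.single a 1) :=
  lift_of Γ _ _ a

theorem of_ne_one (a : V) : of Γ a ≠ 1 := fun h => by
  have hsum := congrArg (exponentSum Γ) h
  rw [exponentSum_of, map_one, ofAdd_eq_one] at hsum
  exact Finsupp.single_ne_zero.mpr one_ne_zero hsum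

theorem of_injective : Function.Injective (of Γ) := fun a b h => by
  have hsum := congrArg (exponentSum Γ) h
  rw [exponentSum_of, exponentSum_of] at hsum
  exact Finsupp.single_left_injective one_ne_zero (Multiplicative.ofAdd.injective hsum)

theorem exists_hom_of_not_adj {G : Type w} [Group G] {a b : V} (hab : ¬ Γ.Adj a b) (s t : G) :
    ∃ f : RAAG Γ →* G, f (of Γ a) = s ∧ f (of Γ b) = t := by
  classical
  have hne : b ≠ a := by
    rintro rfl
    exact hab (Γ.refl b)
  have hba : ¬ Γ.Adj b a := fun h => hab (Γ.symm b a h)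
  refine ⟨lift Γ (fun c => if c = a then s else if c = b then t else 1) fun c d hcd => ?_, ?_, ?_⟩
  · split_ifs <;> simp_all
  · rw [lift_of, if_pos rfl]
  · rw [lift_of, if_neg hne, if_pos rfl]

theorem adj_of_commute_of {a b : V} (h : Commute (of Γ a) (of Γ b)) : Γ.Adj a b := by
  by_contra hab
  obtain ⟨f, hfa, hfb⟩ := exists_hom_of_not_adj hab
    (Equiv.swap 0 1 : Equiv.Perm (Fin 3)) (Equiv.swap 1 2)
  have hswap := h.map f
  rw [hfa, hfb] at hswap
  exact absurd hswap.eq (by decide)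

theorem isFullEmbedding_unit (Γ : ReflGraph V) : (unit Γ).IsFullEmbedding where
  injective := of_injective
  adj_of_adj _ _ := adj_of_commute_of

end Vertices

section Retract

variable {V : Type u} {W : Type v} {Γ : ReflGraph V} {Δ : ReflGraph W} {φ : Γ.Hom Δ}

/-- The left inverse `AΔ → AΓ` of `Aφ` for a full embedding `φ`; it kills the vertices outside the
image of `φ`. -/
noncomputable def retract (hφ : φ.IsFullEmbedding) : RAAG Δ →* RAAG Γ :=
  lift Δ (Function.extend φ.toFun (of Γ) 1) fun b c hbc => by
    by_cases hb : ∃ a, φ.toFun a = b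
    · by_cases hc : ∃ a, φ.toFun a = c
      · obtain ⟨a, rfl⟩ := hb
        obtain ⟨a', rfl⟩ := hc
        rw [hφ.injective.extend_apply, hφ.injective.extend_apply]
        exact commute_of Γ (hφ.adj_of_adj a a' hbc)
      · rw [Function.extend_apply' _ _ c hc]
        exact Commute.one_right _
    · rw [Function.extend_apply' _ _ b hb]
      exact Commute.one_left _

theorem retract_of_apply (hφ : φ.IsFullEmbedding) (a : V) :
    retract hφ (of Δ (φ.toFun a)) = of Γ a := by
  rw [retract, lift_of, hφ.injective.extend_apply]

theorem retract_of_notMem_range (hφ : φ.IsFullEmbedding) {b : W} (hb : b ∉ Set.range φ.toFun) :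
    retract hφ (of Δ b) = 1 := by
  rw [retract, lift_of, Function.extend_apply' _ _ b hb, Pi.one_apply]

theorem leftInverse_retract_map (hφ : φ.IsFullEmbedding) :
    Function.LeftInverse (retract hφ) (map φ) := by
  have hcomp : (retract hφ).comp (map φ) = MonoidHom.id (RAAG Γ) :=
    hom_ext fun a => by simp [retract_of_apply hφ]
  exact DFunLike.congr_fun hcomp

theorem map_injective (hφ : φ.IsFullEmbedding) : Function.Injective (map φ) :=
  (leftInverse_retract_map hφ).injective

/-- As `β` is injective, the hypotheses say that `α ∘ i = β ∘ j` is a pullback square of graphs. -/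
theorem retract_comp_map_of_pullback {V' : Type w} {W' : Type x} {Γ' : ReflGraph V'}
    {Δ' : ReflGraph W'} {i : Γ'.Hom Γ} {j : Γ'.Hom Δ'} {α : Γ.Hom Δ} {β : Δ'.Hom Δ}
    (hi : i.IsFullEmbedding) (hβ : β.IsFullEmbedding)
    (hcomm : ∀ c, α.toFun (i.toFun c) = β.toFun (j.toFun c))
    (hpullback : ∀ a b, α.toFun a = β.toFun b → a ∈ Set.range i.toFun) :
    (retract hβ).comp (map α) = (map j).comp (retract hi) := by
  refine hom_ext fun a => ?_
  simp only [MonoidHom.comp_apply, map_of]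
  by_cases ha : a ∈ Set.range i.toFun
  · obtain ⟨c, rfl⟩ := ha
    rw [hcomm, retract_of_apply, retract_of_apply, map_of]
  · have hαa : α.toFun a ∉ Set.range β.toFun := fun ⟨b, hb⟩ => ha (hpullback a b hb.symm)
    rw [retract_of_notMem_range hi ha, retract_of_notMem_range hβ hαa, map_one]

end Retract

end RAAG

namespace AC

variable {G : Type u} {H : Type v} {K : Type w} [Group G] [Group H] [Group K]

@[simp]
theorem map_of (f : G →* H) (g : G) :
    map f (RAAG.of (commGraph G) g) = RAAG.of (commGraph H) (f g) :=
  RAAG.map_of _ g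

@[simp]
theorem counit_of (g : G) : counit G (RAAG.of (commGraph G) g) = g :=
  RAAG.lift_of _ _ _ g

@[simp]
theorem comul_of (g : G) : comul G (RAAG.of (commGraph G) g) =
    RAAG.of (commGraph (AC G)) (RAAG.of (commGraph G) g) :=
  RAAG.map_of _ g

theorem map_id : map (MonoidHom.id G) = MonoidHom.id (AC G) :=
  RAAG.hom_ext fun g => by simp

theorem map_comp (f : H →* K) (g : G →* H) : map (f.comp g) = (map f).comp (map g) :=
  RAAG.hom_ext fun a => by simp

theorem map_injective {f : G →* H} (hf : Function.Injective f) : Function.Injective (map f) :=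
  RAAG.map_injective (commGraph.isFullEmbedding_map hf)

theorem counit_comp_map (f : G →* H) : (counit H).comp (map f) = f.comp (counit G) :=
  RAAG.hom_ext fun a => by simp

theorem comul_comp_map (f : G →* H) : (comul H).comp (map f) = (map (map f)).comp (comul G) :=
  RAAG.hom_ext fun a => by simp

end AC

namespace IsACCohom

variable {G : Type u} {H : Type v} {K : Type w} [Group G] [Group H] [Group K]
  {𝔤 : G →* AC G} {𝔥 : H →* AC H} {𝔨 : K →* AC K}

protected theorem id (𝔤 : G →* AC G) : IsACCohom 𝔤 𝔤 (MonoidHom.id G) := by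
  rw [IsACCohom, AC.map_id, MonoidHom.id_comp, MonoidHom.comp_id]

theorem comp_iff_of_injective {f : H →* K} {g : G →* H} (hf : IsACCohom 𝔥 𝔨 f)
    (hinj : Function.Injective f) : IsACCohom 𝔤 𝔨 (f.comp g) ↔ IsACCohom 𝔤 𝔥 g := by
  rw [IsACCohom] at hf
  rw [IsACCohom, AC.map_comp, MonoidHom.comp_assoc, ← MonoidHom.comp_assoc g, ← hf,
    MonoidHom.comp_assoc, MonoidHom.cancel_left (AC.map_injective hinj), IsACCohom]

theorem comp_iff_of_surjective {f : H →* K} {g : G →* H} (hg : IsACCohom 𝔤 𝔥 g)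
    (hsurj : Function.Surjective g) : IsACCohom 𝔤 𝔨 (f.comp g) ↔ IsACCohom 𝔥 𝔨 f := by
  rw [IsACCohom] at hg
  rw [IsACCohom, AC.map_comp, MonoidHom.comp_assoc, hg, ← MonoidHom.comp_assoc,
    ← MonoidHom.comp_assoc, MonoidHom.cancel_right hsurj, IsACCohom]

theorem symm {e : G ≃* H} (he : IsACCohom 𝔤 𝔥 e.toMonoidHom) :
    IsACCohom 𝔥 𝔤 e.symm.toMonoidHom := by
  refine (he.comp_iff_of_surjective e.surjective).mp ?_
  rw [show e.symm.toMonoidHom.comp e.toMonoidHom = MonoidHom.id G from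
    e.coe_monoidHom_symm_comp_coe_monoidHom]
  exact .id 𝔤

theorem isACCoalgebra_of_injective {f : G →* H} (hf : IsACCohom 𝔤 𝔥 f)
    (hinj : Function.Injective f) (h𝔥 : IsACCoalgebra 𝔥) : IsACCoalgebra 𝔤 := by
  rw [IsACCohom] at hf
  constructor
  · refine (MonoidHom.cancel_left hinj).mp ?_
    calc f.comp ((AC.counit G).comp 𝔤)
        = (AC.counit H).comp ((AC.map f).comp 𝔤) := by
          rw [← MonoidHom.comp_assoc, ← AC.counit_comp_map, MonoidHom.comp_assoc]
      _ = f.comp (MonoidHom.id G) := by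
          rw [hf, ← MonoidHom.comp_assoc, h𝔥.counit_comp, MonoidHom.id_comp, MonoidHom.comp_id]
  · refine (MonoidHom.cancel_left (AC.map_injective (AC.map_injective hinj))).mp ?_
    calc (AC.map (AC.map f)).comp ((AC.map 𝔤).comp 𝔤)
        = (AC.map 𝔥).comp (𝔥.comp f) := by
          rw [← MonoidHom.comp_assoc, ← AC.map_comp, hf, AC.map_comp, MonoidHom.comp_assoc, hf]
      _ = (AC.comul H).comp ((AC.map f).comp 𝔤) := by
          rw [← MonoidHom.comp_assoc, h𝔥.coassoc, MonoidHom.comp_assoc, hf]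
      _ = (AC.map (AC.map f)).comp ((AC.comul G).comp 𝔤) := by
          rw [← MonoidHom.comp_assoc, AC.comul_comp_map, MonoidHom.comp_assoc]

end IsACCohom

theorem RAAG.isACCoalgebra_canonical {V : Type u} (Γ : ReflGraph V) :
    IsACCoalgebra (RAAG.canonical Γ) where
  counit_comp := RAAG.hom_ext fun a => by simp
  coassoc := RAAG.hom_ext fun a => by simp

theorem IsACCoalgebra.exists_of_mulEquiv {G : Type u} {H : Type v} [Group G] [Group H]
    {𝔥 : H →* AC H} (h𝔥 : IsACCoalgebra 𝔥) (e : G ≃* H) : ∃ 𝔤 : G →* AC G, IsACCoalgebra 𝔤 := by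
  refine ⟨(AC.map e.symm.toMonoidHom).comp (𝔥.comp e.toMonoidHom),
    IsACCohom.isACCoalgebra_of_injective (f := e.toMonoidHom) ?_ e.injective h𝔥⟩
  rw [IsACCohom, ← MonoidHom.comp_assoc, ← AC.map_comp,
    show e.toMonoidHom.comp e.symm.toMonoidHom = MonoidHom.id H from
      e.coe_monoidHom_comp_coe_monoidHom_symm,
    AC.map_id, MonoidHom.id_comp]

/-- The elements `g` of `G` with `𝔤 g = [g]`; they are to the coalgebra `(G, 𝔤)` what the vertices
are to `AΓ`. -/
def AC.vertexSet {G : Type u} [Group G] (𝔤 : G →* AC G) : Set G :=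
  {g | 𝔤 g = RAAG.of (commGraph G) g}

theorem IsACCohom.mapsTo_vertexSet {G : Type u} {H : Type v} [Group G] [Group H]
    {𝔤 : G →* AC G} {𝔥 : H →* AC H} {f : G →* H} (hf : IsACCohom 𝔤 𝔥 f) :
    Set.MapsTo f (AC.vertexSet 𝔤) (AC.vertexSet 𝔥) := fun g hg =>
  calc 𝔥 (f g) = AC.map f (𝔤 g) := (DFunLike.congr_fun hf g).symm
    _ = RAAG.of (commGraph H) (f g) := by rw [hg, AC.map_of]

namespace RAAG

variable {V : Type u} {W : Type v} {Γ : ReflGraph V} {Δ : ReflGraph W}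

theorem vertexSet_canonical (Γ : ReflGraph V) :
    AC.vertexSet (canonical Γ) = Set.range (of Γ) := by
  refine Set.Subset.antisymm (fun x hx => ?_) (Set.range_subset_iff.mpr canonical_of)
  by_contra hrange
  have hx_one : x = 1 :=
    calc x = retract (isFullEmbedding_unit Γ) (canonical Γ x) :=
          (leftInverse_retract_map (isFullEmbedding_unit Γ) x).symm
      _ = 1 := by rw [hx, retract_of_notMem_range (isFullEmbedding_unit Γ) hrange]
  subst hx_one
  exact of_ne_one 1 (hx.symm.trans (map_one (canonical Γ)))

theorem isACCohom_map (φ : Γ.Hom Δ) : IsACCohom (canonical Γ) (canonical Δ) (map φ) :=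
  hom_ext fun a => by simp

theorem exists_eq_map_of_mapsTo {f : RAAG Γ →* RAAG Δ}
    (hf : Set.MapsTo f (Set.range (of Γ)) (Set.range (of Δ))) : ∃ φ : Γ.Hom Δ, f = map φ := by
  choose φ hφ using fun a => hf (Set.mem_range_self a)
  refine ⟨⟨φ, fun a b hab => adj_of_commute_of ?_⟩, hom_ext fun a => ?_⟩
  · rw [hφ, hφ]
    exact (commute_of Γ hab).map f
  · rw [map_of, hφ]

theorem exists_eq_map_iff (f : RAAG Γ →* RAAG Δ) :
    (∃ φ : Γ.Hom Δ, f = map φ) ↔ IsACCohom (canonical Γ) (canonical Δ) f := by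
  constructor
  · rintro ⟨φ, rfl⟩
    exact isACCohom_map φ
  · intro hf
    refine exists_eq_map_of_mapsTo ?_
    simpa only [vertexSet_canonical] using hf.mapsTo_vertexSet

theorem exists_comp_eq_map_comp_iff {G : Type w} {H : Type x} [Group G] [Group H]
    {𝔤 : G →* AC G} {𝔥 : H →* AC H} {e : G ≃* RAAG Γ} {e' : H ≃* RAAG Δ}
    (he : IsACCohom 𝔤 (canonical Γ) e.toMonoidHom) (he' : IsACCohom 𝔥 (canonical Δ) e'.toMonoidHom)
    (f : G →* H) :
    (∃ φ : Γ.Hom Δ, e'.toMonoidHom.comp f = (map φ).comp e.toMonoidHom) ↔ IsACCohom 𝔤 𝔥 f := by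
  rw [← he'.comp_iff_of_injective e'.injective]
  constructor
  · rintro ⟨φ, hφ⟩
    rw [hφ, he.comp_iff_of_surjective e.surjective]
    exact isACCohom_map φ
  · intro hf
    have hconj : ((e'.toMonoidHom.comp f).comp e.symm.toMonoidHom).comp e.toMonoidHom =
        e'.toMonoidHom.comp f := by
      ext; simp
    rw [← hconj, he.comp_iff_of_surjective e.surjective] at hf
    obtain ⟨φ, hφ⟩ := (exists_eq_map_iff _).mpr hf
    exact ⟨φ, by rw [← hφ, hconj]⟩

end RAAG

namespace AC

variable {G : Type u} [Group G] (𝔤 : G →* AC G)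

/-- The full subgraph of `CG` on the elements `g` with `𝔤 g = [g]`: the equalizer of `C𝔤` and the
unit of `CG`. -/
def vertexGraph : ReflGraph (vertexSet 𝔤) :=
  (commGraph G).induce (vertexSet 𝔤)

/-- The inclusion of the graph of vertices of `(G, 𝔤)` into `CG`. -/
def vertexIncl : (vertexGraph 𝔤).Hom (commGraph G) :=
  (commGraph G).induceHom (vertexSet 𝔤)

theorem isFullEmbedding_vertexIncl : (vertexIncl 𝔤).IsFullEmbedding :=
  (commGraph G).isFullEmbedding_induceHom (vertexSet 𝔤)

/-- The comparison homomorphism from the right-angled Artin group on the vertices of `(G, 𝔤)`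
to `G`, sending each vertex to itself. -/
def comparison : RAAG (vertexGraph 𝔤) →* G :=
  (counit G).comp (RAAG.map (vertexIncl 𝔤))

@[simp]
theorem comparison_of (a : vertexSet 𝔤) : comparison 𝔤 (RAAG.of (vertexGraph 𝔤) a) = a := by
  rw [comparison, MonoidHom.comp_apply, RAAG.map_of, counit_of]
  rfl

theorem comp_comparison : 𝔤.comp (comparison 𝔤) = RAAG.map (vertexIncl 𝔤) :=
  RAAG.hom_ext fun a => by
    rw [MonoidHom.comp_apply, comparison_of, RAAG.map_of]
    exact a.2

theorem comparison_injective : Function.Injective (comparison 𝔤) := by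
  have hincl := RAAG.map_injective (isFullEmbedding_vertexIncl 𝔤)
  rw [← comp_comparison] at hincl
  exact Function.Injective.of_comp hincl

theorem isACCohom_comparison :
    IsACCohom (RAAG.canonical (vertexGraph 𝔤)) 𝔤 (comparison 𝔤) :=
  RAAG.hom_ext fun a => by
    simpa only [MonoidHom.comp_apply, RAAG.canonical_of, map_of, comparison_of] using a.2.symm

end AC

namespace IsACCoalgebra

variable {G : Type u} [Group G] {𝔤 : G →* AC G}

theorem counit_apply (h : IsACCoalgebra 𝔤) (g : G) : AC.counit G (𝔤 g) = g :=
  DFunLike.congr_fun h.counit_comp g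

theorem coassoc_apply (h : IsACCoalgebra 𝔤) (g : G) : AC.map 𝔤 (𝔤 g) = AC.comul G (𝔤 g) :=
  DFunLike.congr_fun h.coassoc g

theorem retract_unit_comp_map (h : IsACCoalgebra 𝔤) :
    (RAAG.retract (RAAG.isFullEmbedding_unit (commGraph G))).comp (AC.map 𝔤) =
      (RAAG.map (AC.vertexIncl 𝔤)).comp (RAAG.retract (AC.isFullEmbedding_vertexIncl 𝔤)) := by
  refine RAAG.retract_comp_map_of_pullback _ _ (fun a => a.2) fun g g' hgg' => ?_
  change 𝔤 g = RAAG.of (commGraph G) g' at hgg'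
  have hg : g = g' := by rw [← h.counit_apply g, hgg', AC.counit_of]
  exact ⟨⟨g, hgg'.trans (by rw [hg])⟩, rfl⟩

theorem map_retract_vertexIncl (h : IsACCoalgebra 𝔤) (g : G) :
    RAAG.map (AC.vertexIncl 𝔤) (RAAG.retract (AC.isFullEmbedding_vertexIncl 𝔤) (𝔤 g)) = 𝔤 g :=
  have hunit := RAAG.isFullEmbedding_unit (commGraph G)
  calc RAAG.map (AC.vertexIncl 𝔤) (RAAG.retract (AC.isFullEmbedding_vertexIncl 𝔤) (𝔤 g))
      = RAAG.retract hunit (AC.map 𝔤 (𝔤 g)) :=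
        (DFunLike.congr_fun h.retract_unit_comp_map (𝔤 g)).symm
    _ = RAAG.retract hunit (AC.comul G (𝔤 g)) := by rw [h.coassoc_apply]
    _ = 𝔤 g := RAAG.leftInverse_retract_map hunit (𝔤 g)

theorem comparison_surjective (h : IsACCoalgebra 𝔤) : Function.Surjective (AC.comparison 𝔤) :=
  fun g => ⟨RAAG.retract (AC.isFullEmbedding_vertexIncl 𝔤) (𝔤 g), by
    rw [AC.comparison, MonoidHom.comp_apply, h.map_retract_vertexIncl, h.counit_apply]⟩

theorem exists_mulEquiv_isACCohom (h : IsACCoalgebra 𝔤) :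
    ∃ e : G ≃* RAAG (AC.vertexGraph 𝔤),
      IsACCohom 𝔤 (RAAG.canonical (AC.vertexGraph 𝔤)) e.toMonoidHom := by
  let e : RAAG (AC.vertexGraph 𝔤) ≃* G :=
    MulEquiv.ofBijective (AC.comparison 𝔤) ⟨AC.comparison_injective 𝔤, h.comparison_surjective⟩
  exact ⟨e.symm, IsACCohom.symm (e := e) (AC.isACCohom_comparison 𝔤)⟩

end IsACCoalgebra

theorem isRAAG_iff_exists_isACCoalgebra (G : Type u) [Group G] :
    IsRAAG G ↔ ∃ 𝔤 : G →* AC G, IsACCoalgebra 𝔤 := by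
  constructor
  · rintro ⟨V, Γ, ⟨e⟩⟩
    exact (RAAG.isACCoalgebra_canonical Γ).exists_of_mulEquiv e
  · rintro ⟨𝔤, h⟩
    obtain ⟨e, -⟩ := h.exists_mulEquiv_isACCohom
    exact ⟨_, _, ⟨e⟩⟩

/-- The conjuncts say, in order:
* a group is isomorphic to a RAAG if and only if it admits an `AC`-coalgebra structure;
* the canonical map `AΓ → AC(AΓ)` is such a structure;
* a homomorphism `AΓ → AΔ` is `Aφ` for a graph homomorphism `φ` if and only if it respects the
  canonical structure maps;
* for arbitrary coalgebra structures: each `(G, 𝔤)` is identified with some `AΓ` and its canonical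
  structure, and under any such identifications of `(G, 𝔤)` with `AΓ` and of `(H, 𝔥)` with `AΔ`,
  a homomorphism `G → H` is `Aφ` for some `φ` if and only if it respects `𝔤` and `𝔥`. -/
theorem mainTheorem2 :
    (∀ (G : Type u) [Group G], IsRAAG G ↔ ∃ 𝔤 : G →* AC G, IsACCoalgebra 𝔤) ∧
    (∀ (V : Type u) (Γ : ReflGraph V), IsACCoalgebra (RAAG.canonical Γ)) ∧
    (∀ (V : Type u) (W : Type v) (Γ : ReflGraph V) (Δ : ReflGraph W) (f : RAAG Γ →* RAAG Δ),
      (∃ φ : Γ.Hom Δ, f = RAAG.map φ) ↔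
        IsACCohom (RAAG.canonical Γ) (RAAG.canonical Δ) f) ∧
    (∀ (G : Type u) [Group G] (𝔤 : G →* AC G), IsACCoalgebra 𝔤 →
      ∃ (V : Type u) (Γ : ReflGraph V) (e : G ≃* RAAG Γ),
        IsACCohom 𝔤 (RAAG.canonical Γ) e.toMonoidHom) ∧
    (∀ (G : Type u) (H : Type v) [Group G] [Group H] (𝔤 : G →* AC G) (𝔥 : H →* AC H),
      IsACCoalgebra 𝔤 → IsACCoalgebra 𝔥 →
      ∀ (V : Type w) (W : Type x) (Γ : ReflGraph V) (Δ : ReflGraph W)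
        (e : G ≃* RAAG Γ) (e' : H ≃* RAAG Δ),
        IsACCohom 𝔤 (RAAG.canonical Γ) e.toMonoidHom →
        IsACCohom 𝔥 (RAAG.canonical Δ) e'.toMonoidHom →
        ∀ f : G →* H,
          (∃ φ : Γ.Hom Δ, e'.toMonoidHom.comp f = (RAAG.map φ).comp e.toMonoidHom) ↔
            IsACCohom 𝔤 𝔥 f) :=
  ⟨fun G _ => isRAAG_iff_exists_isACCoalgebra G,
    fun _ Γ => RAAG.isACCoalgebra_canonical Γ,
    fun _ _ _ _ f => RAAG.exists_eq_map_iff f,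
    fun _ _ _ h => ⟨_, _, h.exists_mulEquiv_isACCohom⟩,
    fun _ _ _ _ _ _ _ _ _ _ _ _ _ _ he he' f => RAAG.exists_comp_eq_map_comp_iff he he' f⟩
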